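/- Let $k\ge 2$ and $\Delta\ge 3$ be integers, let $0<\varepsilon<\frac{1}{16(k+1)^5\Delta^2}$, and let $$\mathcal D_\varepsilon=\{z\in\mathbb C \mid \exists\, b\in[0,1]\text{ such that }|z-b|\le\varepsilon\}.$$ Suppose that $$\sqrt{1+2\varepsilon}\;2^{-k/2}<\frac{1}{2\sqrt2\,\mathrm e\,\Delta\,(k+1)^2}.$$ Let $H=(V,\mathcal E)$ be a finite $k$-uniform hypergraph of maximum degree at most $\Delta$, that is, $V$ is a finite set, $\mathcal E$ is a set of $k$-element subsets of $V$, and every vertex lies in at most $\Delta$ members of $\mathcal E$. For $\boldsymbol\beta=(\beta_e)_{e\in\mathcal E}\in\mathbb C^{\mathcal E}$ let $$Z^{\mathrm{fs}}_H(\boldsymbol\beta)=\sum_{\sigma\in\{0,1\}^V}\ \prod_{\substack{e\in\mathcal E\\ \sigma(v)=1\ \forall v\in e}}\beta_e .$$ Then $Z^{\mathrm{fs}}_H(\boldsymbol\beta)\ne 0$ for all $\boldsymbol\beta\in\mathcal D_\varepsilon^{\mathcal E}$. -/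

import Mathlib

namespace Hypergraph

/-- The number of hyperedges of `H` that contain the vertex `v`. -/
noncomputable def vertexDegree {α : Type*} (H : Hypergraph α) (v : α) : ℕ :=
  {e : Set α | e ∈ H.edgeSet ∧ v ∈ e}.ncard

/-- Every hyperedge of `H` consists of exactly `k` vertices. -/
def IsUniformOfSize {α : Type*} (H : Hypergraph α) (k : ℕ) : Prop :=
  ∀ e ∈ H.edgeSet, e.Finite ∧ e.ncard = k

/-- Every vertex of `H` lies in at most `Δ` hyperedges. -/
def MaxDegreeLE {α : Type*} (H : Hypergraph α) (Δ : ℕ) : Prop :=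
  ∀ v ∈ H.vertexSet, H.vertexDegree v ≤ Δ

open Classical in
/-- The activity of the hyperedge `e` with edge strength `b` under `σ ∈ {0,1}^V`: it is `b` if
all vertices of `e` receive the value `1`, and `1` otherwise. -/
noncomputable def edgeActivity {α : Type*} (H : Hypergraph α) (e : H.edgeSet) (b : ℂ)
    (σ : H.vertexSet → Fin 2) : ℂ :=
  if ∀ v : H.vertexSet, (v : α) ∈ (e : Set α) → σ v = 1 then b else 1

open Classical in
/-- The independence polynomial of a finite hypergraph `H` in the edge strengths `β`:
the sum over all `σ ∈ {0,1}^V` of the product of the edge activities. -/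
noncomputable def fisherPartition {α : Type*} (H : Hypergraph α) [Fintype H.vertexSet]
    [Fintype H.edgeSet] (β : H.edgeSet → ℂ) : ℂ :=
  ∑ σ : H.vertexSet → Fin 2, ∏ e : H.edgeSet, H.edgeActivity e (β e) σ

end Hypergraph

/-- The union of the closed complex `ε`-balls around the points of the real segment `[0,1]`. -/
def unitSegmentNhd (ε : ℝ) : Set ℂ :=
  {z : ℂ | ∃ b : ℝ, b ∈ Set.Icc (0 : ℝ) 1 ∧ ‖z - (b : ℂ)‖ ≤ ε}

/-! The partition function is built up one edge at a time. Adding an edge `R` with strength `b`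
multiplies it by `1 + (b - 1) * μ(R)`, where `μ(R)` is the complex Gibbs probability, without that
edge, that all vertices of `R` carry a one. So it suffices to bound `|μ(R)|` by `1 / 4`.

The complex measure `μ` is stationary for heat-bath updates with complex transition probabilities
(`sum_configWeight_mul_step`). Each update is split into an honest fair coin, which with probability
`1 / 2` sets the vertex to `0`, and a complex step whose coefficients sum to one. Running a
systematic scan and averaging over the coins (`sum_pullback`), `μ(R)` becomes an average over coin
sequences of pulled-back observables. Once the coins are fixed, an edge can influence an update only
if the most recent coins of all its vertices came up in favour of the complex step. Hence the
pulled-back indicator of `R` depends on the vertices reached from `R` through such edges only, all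
other complex steps cancel exactly, and every remaining one costs a factor close to one
(`pullback_bound`). If the explored region dies out before the start of the dynamics, the initial
configuration drops out; otherwise the region is so large that the geometric gain beats the total
variation of `μ`, once the dynamics is run for long enough (`norm_sum_configWeight_le`).

It remains to bound an exponential moment of the size of the explored region. This is a percolation
problem on space-time windows (the most recent updates of the vertices of an edge), each of which
is open with probability `2 ^ (-k)` and meets at most `D = Δ k² + 1` windows. Jumping from an open
window to the windows at distance two, which use fresh coins, gives a subcritical branching process
as soon as `D² 2 ^ (-k)` is small (`sum_openCluster_le`); this is the origin of the exponent `k / 2`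
in the hypothesis. -/

/-! ### Percolation on overlapping windows -/

section Percolation

variable {J P : Type*}

/-- `OpenReach pts Z U S j`: the site `j` is joined to a seed in `S` by a path of sites of `U`, all
of them open (no point of them lies in the set `Z` of closed points), in which consecutive sites
share a point. -/
inductive OpenReach (pts : J → Finset P) (Z : Finset P) (U S : Finset J) : J → Prop
  | seed {j : J} : j ∈ S → j ∈ U → Disjoint (pts j) Z → OpenReach pts Z U S j
  | step {i j : J} : OpenReach pts Z U S i → j ∈ U → Disjoint (pts j) Z →
      ¬ Disjoint (pts i) (pts j) → OpenReach pts Z U S j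

theorem OpenReach.mem {pts : J → Finset P} {Z : Finset P} {U S : Finset J} {j : J}
    (h : OpenReach pts Z U S j) : j ∈ U := by
  cases h <;> assumption

open Classical in
/-- The union of the open clusters of the seeds. -/
noncomputable def openCluster (pts : J → Finset P) (Z : Finset P) (U S : Finset J) : Finset J :=
  U.filter (OpenReach pts Z U S)

theorem mem_openCluster {pts : J → Finset P} {Z : Finset P} {U S : Finset J} {j : J} :
    j ∈ openCluster pts Z U S ↔ OpenReach pts Z U S j := by
  classical
  simp only [openCluster, Finset.mem_filter, and_iff_right_iff_imp]
  exact fun h => h.mem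

/-- The sites of `U` that share a point with `s`. -/
def meeting [DecidableEq P] (pts : J → Finset P) (U : Finset J) (s : J) : Finset J :=
  U.filter fun j => ¬ Disjoint (pts s) (pts j)

theorem openCluster_erase [DecidableEq J] (pts : J → Finset P) (Z : Finset P) (U S : Finset J) (s : J)
    (hs : ¬ Disjoint (pts s) Z) :
    openCluster pts Z U S ⊆ openCluster pts Z (U.erase s) (S.erase s) := by
  intro j hj
  rw [mem_openCluster] at hj ⊢
  have key : ∀ j, Disjoint (pts j) Z → j ≠ s := fun j h1 h2 => hs (h2 ▸ h1)
  induction hj with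
  | seed h1 h2 h3 =>
    exact .seed (Finset.mem_erase.2 ⟨key _ h3, h1⟩) (Finset.mem_erase.2 ⟨key _ h3, h2⟩) h3
  | step _ h2 h3 h4 ih => exact .step ih (Finset.mem_erase.2 ⟨key _ h3, h2⟩) h3 h4

variable [DecidableEq J] [DecidableEq P]

/-- A site of the cluster that does not meet `s` stays reachable once all sites meeting `s` are
deleted, provided the sites at distance two from `s` are made seeds: cut the path after its last
site that meets `s`. -/
theorem openCluster_subset_meeting_union (pts : J → Finset P) (Z : Finset P) (U S : Finset J)
    (s : J) (hne : (pts s).Nonempty) :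
    openCluster pts Z U S ⊆ meeting pts U s ∪ openCluster pts Z (U \ meeting pts U s)
      (S.erase s ∪ (meeting pts U s).biUnion (meeting pts U)) := by
  intro j hj
  rw [mem_openCluster] at hj
  rw [Finset.mem_union, mem_openCluster]
  induction hj with
  | @seed j h1 h2 h3 =>
    by_cases hm : j ∈ meeting pts U s
    · exact .inl hm
    · right
      have hjs : j ≠ s := by
        rintro rfl
        exact hm (Finset.mem_filter.2 ⟨h2, by simpa using hne.ne_empty⟩)
      exact .seed (Finset.mem_union_left _ (Finset.mem_erase.2 ⟨hjs, h1⟩))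
        (Finset.mem_sdiff.2 ⟨h2, hm⟩) h3
  | @step i j h1 h2 h3 h4 ih =>
    by_cases hm : j ∈ meeting pts U s
    · exact .inl hm
    · right
      rcases ih with ih | ih
      · exact .seed (Finset.mem_union_right _ (Finset.mem_biUnion.2
          ⟨i, ih, Finset.mem_filter.2 ⟨h2, h4⟩⟩)) (Finset.mem_sdiff.2 ⟨h2, hm⟩) h3
      · exact .step ih (Finset.mem_sdiff.2 ⟨h2, hm⟩) h3 h4

/-- The points of an open site `s` carry no further information once the sites meeting `s` are
deleted, so that opening `s` costs the factor `2 ^ (-|s|)` hidden in the smaller powerset. -/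
theorem sum_openCluster_of_open (pts : J → Finset P) (U S : Finset J) (X : Finset P) (s : J)
    (D : ℕ) (z : ℝ) (hz : 1 ≤ z) (hne : (pts s).Nonempty) (hD : (meeting pts U s).card ≤ D) :
    ∑ Z ∈ X.powerset with Disjoint (pts s) Z, z ^ (openCluster pts Z U S).card ≤
      z ^ D * ∑ Z ∈ (X \ pts s).powerset, z ^ (openCluster pts Z (U \ meeting pts U s)
        (S.erase s ∪ (meeting pts U s).biUnion (meeting pts U))).card := by
  have hset : X.powerset.filter (fun Z => Disjoint (pts s) Z) = (X \ pts s).powerset := by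
    ext Z
    simp only [Finset.mem_filter, Finset.mem_powerset, Finset.subset_sdiff]
    rw [disjoint_comm]
  rw [hset, Finset.mul_sum]
  refine Finset.sum_le_sum fun Z _ => ?_
  rw [← pow_add]
  refine pow_le_pow_right₀ hz ?_
  calc _ ≤ _ := Finset.card_le_card (openCluster_subset_meeting_union pts Z U S s hne)
    _ ≤ _ := Finset.card_union_le _ _
    _ ≤ _ := Nat.add_le_add_right hD _

theorem card_erase_union_biUnion_meeting (pts : J → Finset P) (U S : Finset J) (s : J) (D : ℕ)
    (hs : s ∈ S) (hsU : s ∈ U) (hD : ∀ j ∈ U, (meeting pts U j).card ≤ D) :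
    (S.erase s ∪ (meeting pts U s).biUnion (meeting pts U)).card ≤ (S.card - 1) + D ^ 2 := by
  refine (Finset.card_union_le _ _).trans ?_
  rw [Finset.card_erase_of_mem hs]
  gcongr
  calc _ ≤ (meeting pts U s).card * D :=
        Finset.card_biUnion_le_card_mul _ _ _ fun j hj => hD j (Finset.mem_filter.1 hj).1
    _ ≤ D ^ 2 := by rw [sq]; exact Nat.mul_le_mul_right _ (hD s hsU)

/-- Exponential moment of the open cluster. Examine the seeds one at a time. A closed seed is
discarded; an open seed has probability `2 ^ (-k)`, accounts for the at most `D` sites it meets, and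
is replaced by the at most `D ^ 2` sites at distance two, whose status is independent of it. -/
theorem sum_openCluster_le (pts : J → Finset P) (k D : ℕ) (hk : 0 < k) (z y : ℝ) (hz : 1 ≤ z)
    (hy : 0 ≤ y) (hzy : z ^ D * (1 / 2) ^ k * (1 + y) ^ D ^ 2 ≤ y) (U S : Finset J) (X : Finset P)
    (hX : ∀ j ∈ U, pts j ⊆ X) (hcard : ∀ j ∈ U, (pts j).card = k)
    (hD : ∀ j ∈ U, (meeting pts U j).card ≤ D) :
    ∑ Z ∈ X.powerset, z ^ (openCluster pts Z U S).card ≤ 2 ^ X.card * (1 + y) ^ S.card := by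
  induction hn : U.card using Nat.strong_induction_on generalizing U S X with
  | _ n ih =>
  have hmono : ∀ U' ⊆ U, ∀ j ∈ U', (meeting pts U' j).card ≤ D := fun U' hU' j hj =>
    (Finset.card_le_card (Finset.filter_subset_filter _ hU')).trans (hD j (hU' hj))
  by_cases hSU : ∃ s ∈ S, s ∈ U
  · obtain ⟨s, hsS, hsU⟩ := hSU
    have hne : (pts s).Nonempty := Finset.card_pos.1 (by rw [hcard s hsU]; exact hk)
    rw [← Finset.sum_filter_add_sum_filter_not _ (fun Z => Disjoint (pts s) Z)]
    have hclosed : ∑ Z ∈ X.powerset with ¬ Disjoint (pts s) Z, z ^ (openCluster pts Z U S).card ≤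
        2 ^ X.card * (1 + y) ^ (S.card - 1) := by
      calc _ ≤ ∑ Z ∈ X.powerset with ¬ Disjoint (pts s) Z,
              z ^ (openCluster pts Z (U.erase s) (S.erase s)).card := by
            refine Finset.sum_le_sum fun Z hZ => pow_le_pow_right₀ hz (Finset.card_le_card ?_)
            exact openCluster_erase _ _ _ _ _ (Finset.mem_filter.1 hZ).2
        _ ≤ ∑ Z ∈ X.powerset, z ^ (openCluster pts Z (U.erase s) (S.erase s)).card :=
            Finset.sum_le_sum_of_subset_of_nonneg (Finset.filter_subset _ _)
              fun _ _ _ => by positivity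
        _ ≤ _ := by
            rw [← Finset.card_erase_of_mem hsS]
            exact ih _ (hn ▸ Finset.card_erase_lt_of_mem hsU) _ _ _
              (fun j hj => hX j (Finset.mem_of_mem_erase hj))
              (fun j hj => hcard j (Finset.mem_of_mem_erase hj))
              (hmono _ (Finset.erase_subset _ _)) rfl
    have hopen : ∑ Z ∈ X.powerset with Disjoint (pts s) Z, z ^ (openCluster pts Z U S).card ≤
        2 ^ X.card * (1 + y) ^ (S.card - 1) * y := by
      have hsub : U \ meeting pts U s ⊆ U := Finset.sdiff_subset
      have hlt : (U \ meeting pts U s).card < n := by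
        rw [← hn]
        refine Finset.card_lt_card (Finset.ssubset_iff_subset_ne.2 ⟨hsub, fun h => ?_⟩)
        have : s ∈ U \ meeting pts U s := h.ge hsU
        exact (Finset.mem_sdiff.1 this).2
          (Finset.mem_filter.2 ⟨hsU, by simpa using hne.ne_empty⟩)
      have hrec := ih _ hlt (U \ meeting pts U s)
        (S.erase s ∪ (meeting pts U s).biUnion (meeting pts U)) (X \ pts s)
        (fun j hj => Finset.subset_sdiff.2 ⟨hX j (hsub hj), by
          by_contra hd
          exact (Finset.mem_sdiff.1 hj).2
            (Finset.mem_filter.2 ⟨hsub hj, fun h => hd h.symm⟩)⟩)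
        (fun j hj => hcard j (hsub hj)) (hmono _ hsub) rfl
      have h2 : (2 : ℝ) ^ (X \ pts s).card = 2 ^ X.card * (1 / 2) ^ k := by
        have hc := Finset.card_sdiff_add_card_eq_card (hX s hsU)
        rw [hcard s hsU] at hc
        rw [← hc, pow_add, mul_assoc, ← mul_pow]
        norm_num
      calc _ ≤ _ := sum_openCluster_of_open pts U S X s D z hz hne (hD s hsU)
        _ ≤ z ^ D * (2 ^ X.card * (1 / 2) ^ k * (1 + y) ^ ((S.card - 1) + D ^ 2)) := by
            rw [← h2]
            refine mul_le_mul_of_nonneg_left (hrec.trans ?_) (by positivity)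
            refine mul_le_mul_of_nonneg_left ?_ (by positivity)
            exact pow_le_pow_right₀ (by linarith)
              (card_erase_union_biUnion_meeting pts U S s D hsS hsU hD)
        _ = 2 ^ X.card * (1 + y) ^ (S.card - 1) *
              (z ^ D * (1 / 2) ^ k * (1 + y) ^ D ^ 2) := by rw [pow_add]; ring
        _ ≤ _ := mul_le_mul_of_nonneg_left hzy (by positivity)
    have hS : S.card - 1 + 1 = S.card := Nat.succ_pred_eq_of_pos (Finset.card_pos.2 ⟨s, hsS⟩)
    calc _ ≤ 2 ^ X.card * (1 + y) ^ (S.card - 1) * y + 2 ^ X.card * (1 + y) ^ (S.card - 1) :=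
          add_le_add hopen hclosed
      _ = 2 ^ X.card * (1 + y) ^ (S.card - 1 + 1) := by rw [pow_succ]; ring
      _ = _ := by rw [hS]
  · have hempty : ∀ Z, openCluster pts Z U S = ∅ := by
      intro Z
      refine Finset.eq_empty_of_forall_notMem fun j hj => ?_
      rw [mem_openCluster] at hj
      induction hj with
      | seed h1 h2 _ => exact hSU ⟨_, h1, h2⟩
      | step _ _ _ _ ih => exact ih
    simp only [hempty, Finset.card_empty, pow_zero, Finset.sum_const, nsmul_eq_mul, mul_one,
      Finset.card_powerset, Nat.cast_pow, Nat.cast_ofNat]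
    exact le_mul_of_one_le_right (by positivity) (one_le_pow₀ (by linarith))

/-- The exponential moment of the open cluster of a single site `s`, on the event that `s` is
open. -/
theorem sum_openCluster_singleton_le (pts : J → Finset P) (k D : ℕ) (hk : 0 < k) (z y : ℝ)
    (hz : 1 ≤ z) (hy : 0 ≤ y) (hzy : z ^ D * (1 / 2) ^ k * (1 + y) ^ D ^ 2 ≤ y) (U : Finset J)
    (X : Finset P) (hX : ∀ j ∈ U, pts j ⊆ X) (hcard : ∀ j ∈ U, (pts j).card = k)
    (hD : ∀ j ∈ U, (meeting pts U j).card ≤ D) (s : J) (hs : s ∈ U) :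
    ∑ Z ∈ X.powerset with Disjoint (pts s) Z, z ^ (openCluster pts Z U {s}).card ≤
      2 ^ X.card * (y + (1 / 2) ^ k) := by
  have h := sum_openCluster_le pts k D hk z y hz hy hzy U {s} X hX hcard hD
  rw [← Finset.sum_filter_add_sum_filter_not _ (fun Z => Disjoint (pts s) Z)] at h
  have hX2 : X.powerset.filter (fun Z => Disjoint (pts s) Z) = (X \ pts s).powerset := by
    ext Z
    simp only [Finset.mem_filter, Finset.mem_powerset, Finset.subset_sdiff]
    rw [disjoint_comm]
  have hc := Finset.card_filter_add_card_filter_not (s := X.powerset)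
    (fun Z => Disjoint (pts s) Z)
  rw [hX2, Finset.card_powerset, Finset.card_powerset] at hc
  have hclosed : ((X.powerset.filter (fun Z => ¬ Disjoint (pts s) Z)).card : ℝ) ≤
      ∑ Z ∈ X.powerset with ¬ Disjoint (pts s) Z, z ^ (openCluster pts Z U {s}).card := by
    rw [← nsmul_one, ← Finset.sum_const]
    exact Finset.sum_le_sum fun _ _ => one_le_pow₀ hz
  have h2 : (2 : ℝ) ^ (X \ pts s).card = 2 ^ X.card * (1 / 2) ^ k := by
    have hc := Finset.card_sdiff_add_card_eq_card (hX s hs)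
    rw [hcard s hs] at hc
    rw [← hc, pow_add, mul_assoc, ← mul_pow]
    norm_num
  have hc' : (2 : ℝ) ^ (X \ pts s).card +
      ((X.powerset.filter (fun Z => ¬ Disjoint (pts s) Z)).card : ℝ) = 2 ^ X.card := by
    exact_mod_cast hc
  simp only [Finset.card_singleton, pow_one] at h
  linarith

end Percolation

/-! ### Complex heat-bath dynamics -/

section Chain

variable {V ι : Type*} [DecidableEq V] (E : ι → Finset V) (β : ι → ℂ) (A : Finset ι)

/-- The weight of the configuration whose set of ones is `σ`, for the hypergraph with edges `E i`,
`i ∈ A`. -/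
def configWeight (σ : Finset V) : ℂ := ∏ i ∈ A with E i ⊆ σ, β i

/-- The ratio of the weights of `insert v σ` and `σ.erase v`. It is a polynomial in the edge
strengths, hence meaningful even where the weights vanish. -/
def flipRatio (v : V) (σ : Finset V) : ℂ := ∏ i ∈ A with v ∈ E i ∧ E i ⊆ insert v σ, β i

theorem configWeight_insert (v : V) (σ : Finset V) (hv : v ∉ σ) :
    configWeight E β A (insert v σ) = configWeight E β A σ * flipRatio E β A v σ := by
  classical
  rw [configWeight, configWeight, flipRatio, ← Finset.prod_union]
  · congr 1
    ext i
    simp only [Finset.mem_filter, Finset.mem_union]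
    constructor
    · rintro ⟨hi, h⟩
      by_cases hvi : v ∈ E i
      · exact .inr ⟨hi, hvi, h⟩
      · exact .inl ⟨hi, (Finset.subset_insert_iff_of_notMem hvi).1 h⟩
    · rintro (⟨hi, h⟩ | ⟨hi, _, h⟩)
      · exact ⟨hi, h.trans (Finset.subset_insert _ _)⟩
      · exact ⟨hi, h⟩
  · rw [Finset.disjoint_left]
    intro i h1 h2
    exact hv ((Finset.mem_filter.1 h1).2 (Finset.mem_filter.1 h2).2.1)

/-- Heat-bath resampling at `v` gives `v` the value `0` with complex probability `1 / (1 + B)`,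
where `B` is the flip ratio. It is an even mixture of "set `v` to `0`" and the step defined here. -/
noncomputable def lazyStep (v : V) (f : Finset V → ℂ) (σ : Finset V) : ℂ :=
  (1 - flipRatio E β A v σ) / (1 + flipRatio E β A v σ) * f (σ.erase v) +
    2 * flipRatio E β A v σ / (1 + flipRatio E β A v σ) * f (insert v σ)

theorem sum_eq_sum_erase_powerset [Fintype V] (v : V) (g : Finset V → ℂ) :
    ∑ σ, g σ = ∑ τ ∈ (Finset.univ.erase v).powerset, (g τ + g (insert v τ)) := by
  rw [Finset.sum_add_distrib, ← Finset.sum_powerset_insert (Finset.notMem_erase v _),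
    Finset.insert_erase (Finset.mem_univ v), Finset.powerset_univ]

theorem flipRatio_insert (v : V) (σ : Finset V) :
    flipRatio E β A v (insert v σ) = flipRatio E β A v σ := by
  simp [flipRatio]

/-- The heat-bath step preserves the complex Gibbs measure. -/
theorem sum_configWeight_mul_step [Fintype V] (v : V) (f : Finset V → ℂ)
    (hB : ∀ σ, 1 + flipRatio E β A v σ ≠ 0) :
    ∑ σ, configWeight E β A σ * f (σ.erase v) +
      ∑ σ, configWeight E β A σ * lazyStep E β A v f σ =
    2 * ∑ σ, configWeight E β A σ * f σ := by
  rw [← Finset.sum_add_distrib, sum_eq_sum_erase_powerset v, sum_eq_sum_erase_powerset v,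
    Finset.mul_sum]
  refine Finset.sum_congr rfl fun τ hτ => ?_
  have hv : v ∉ τ := fun h => Finset.notMem_erase v _ (Finset.mem_powerset.1 hτ h)
  have h1 := hB τ
  simp only [lazyStep, flipRatio_insert, configWeight_insert E β A v τ hv, Finset.insert_idem,
    Finset.erase_insert hv, Finset.erase_eq_of_notMem hv]
  field_simp
  ring

/-- The observable `f` pulled back through `s` steps of the dynamics. Time is counted backwards
from the present: step `s` resamples the vertex `x s`, setting it to `0` if `s ∈ Z` and applying
`lazyStep` otherwise. -/
noncomputable def pullback (x : ℕ → V) (Z : Finset ℕ) (f : Finset V → ℂ) : ℕ → Finset V → ℂ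
  | 0 => f
  | s + 1 => fun σ => if s ∈ Z then pullback x Z f s (σ.erase (x s))
      else lazyStep E β A (x s) (pullback x Z f s) σ

theorem pullback_congr (x : ℕ → V) (Z Z' : Finset ℕ) (f : Finset V → ℂ) (s : ℕ)
    (h : ∀ t < s, t ∈ Z ↔ t ∈ Z') : pullback E β A x Z f s = pullback E β A x Z' f s := by
  induction s with
  | zero => rfl
  | succ s ih =>
    have ih := ih fun t ht => h t (by omega)
    funext σ
    simp only [pullback, ih, h s (by omega)]

/-- Averaging over the coins recovers the stationary dynamics. -/
theorem sum_pullback [Fintype V] (x : ℕ → V) (f : Finset V → ℂ)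
    (hB : ∀ v σ, 1 + flipRatio E β A v σ ≠ 0) (N : ℕ) :
    ∑ Z ∈ (Finset.range N).powerset, ∑ σ, configWeight E β A σ * pullback E β A x Z f N σ =
      2 ^ N * ∑ σ, configWeight E β A σ * f σ := by
  induction N with
  | zero => simp [pullback]
  | succ N ih =>
    rw [pow_succ, mul_comm _ (2 : ℂ), mul_assoc, ← ih, Finset.range_add_one,
      Finset.sum_powerset_insert Finset.notMem_range_self, ← Finset.sum_add_distrib,
      Finset.mul_sum]
    refine Finset.sum_congr rfl fun Z hZ => ?_
    have hN : N ∉ Z := fun h => Finset.notMem_range_self (Finset.mem_powerset.1 hZ h)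
    rw [← sum_configWeight_mul_step E β A (x N) _ (hB _), add_comm]
    have hc : pullback E β A x (insert N Z) f N = pullback E β A x Z f N :=
      pullback_congr E β A x _ _ f N fun t ht => by simp [ht.ne]
    simp [pullback, hN, hc]

end Chain

/-! ### The systematic scan -/

section Schedule

variable {V : Type*} [Fintype V] [Nonempty V]

/-- The vertex updated at time `s` by the systematic scan. -/
noncomputable def scan (s : ℕ) : V :=
  (Fintype.equivFin V).symm ⟨s % Fintype.card V, Nat.mod_lt _ Fintype.card_pos⟩

theorem scan_eq_scan_iff {s t : ℕ} :
    (scan s : V) = scan t ↔ s % Fintype.card V = t % Fintype.card V := by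
  simp [scan]

theorem scan_injOn {s t p : ℕ} (h : (scan s : V) = scan t) (hs : s ≤ p)
    (hs' : p < s + Fintype.card V) (ht : t ≤ p) (ht' : p < t + Fintype.card V) : s = t := by
  rw [scan_eq_scan_iff] at h
  rcases le_total s t with hst | hst
  · have := (Nat.modEq_iff_dvd' hst).1 h
    have := Nat.eq_zero_of_dvd_of_lt this (by omega)
    omega
  · have := (Nat.modEq_iff_dvd' hst).1 h.symm
    have := Nat.eq_zero_of_dvd_of_lt this (by omega)
    omega

theorem exists_scan_eq (u : V) (s : ℕ) : ∃ t, s ≤ t ∧ t < s + Fintype.card V ∧ scan t = u := by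
  have hn : 0 < Fintype.card V := Fintype.card_pos
  set n := Fintype.card V with hn'
  obtain ⟨r, hrn, hr⟩ : ∃ r, ∃ h : r < n, Fintype.equivFin V u = ⟨r, h⟩ :=
    ⟨_, (Fintype.equivFin V u).isLt, rfl⟩
  have hsn := Nat.mod_lt s hn
  have key : ∀ t, t % n = r → (scan t : V) = u := by
    intro t ht
    rw [scan, Equiv.symm_apply_eq, hr]
    exact Fin.ext ht
  have hdiv := Nat.mod_add_div s n
  rcases le_or_gt (s % n) r with h | h
  · refine ⟨s - s % n + r, by omega, by omega, key _ ?_⟩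
    have : s - s % n + r = r + n * (s / n) := by omega
    rw [this, Nat.add_mul_mod_self_left, Nat.mod_eq_of_lt hrn]
  · refine ⟨s - s % n + n + r, by omega, by omega, key _ ?_⟩
    have : s - s % n + n + r = r + n * (s / n + 1) := by rw [mul_add]; omega
    rw [this, Nat.add_mul_mod_self_left, Nat.mod_eq_of_lt hrn]

/-- The first time from `s` on at which `u` is updated. As time runs backwards, this is the most
recent update of `u` before `s`. -/
noncomputable def nextVisit (u : V) (s : ℕ) : ℕ := (exists_scan_eq u s).choose

theorem le_nextVisit (u : V) (s : ℕ) : s ≤ nextVisit u s := (exists_scan_eq u s).choose_spec.1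

theorem nextVisit_lt (u : V) (s : ℕ) : nextVisit u s < s + Fintype.card V :=
  (exists_scan_eq u s).choose_spec.2.1

@[simp]
theorem scan_nextVisit (u : V) (s : ℕ) : scan (nextVisit u s) = u :=
  (exists_scan_eq u s).choose_spec.2.2

theorem nextVisit_injective (s : ℕ) : Function.Injective fun u : V => nextVisit u s := by
  intro u u' h
  rw [← scan_nextVisit u s, ← scan_nextVisit u' s]
  exact congrArg _ h

theorem nextVisit_scan (s : ℕ) : nextVisit (scan s : V) s = s := by
  have hn : 0 < Fintype.card V := Fintype.card_pos
  have h1 := le_nextVisit (scan s : V) s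
  have h2 := nextVisit_lt (scan s : V) s
  exact scan_injOn (V := V) (p := nextVisit (scan s : V) s) (scan_nextVisit _ _) le_rfl
    (by omega) h1 h2

theorem nextVisit_succ {u : V} {s : ℕ} (h : u ≠ scan s) :
    nextVisit u (s + 1) = nextVisit u s := by
  have hn : 0 < Fintype.card V := Fintype.card_pos
  have h1 := le_nextVisit u s
  have h2 := nextVisit_lt u s
  have h3 := le_nextVisit u (s + 1)
  have h4 := nextVisit_lt u (s + 1)
  have h5 : nextVisit u s ≠ s := fun h' => h (by rw [← scan_nextVisit u s, h'])
  exact scan_injOn (V := V) (p := s + Fintype.card V) (by simp) (by omega) (by omega) (by omega)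
    (by omega)

end Schedule

/-! ### Dependence of the pullback on the coins -/

section LiveSet

variable {V ι : Type*} [Fintype V] [Nonempty V]

/-- The vertices that may carry a one just before step `s` is applied: those whose most recent
update was not forced to `0`. -/
noncomputable def possibleOnes (Z : Finset ℕ) (s : ℕ) : Finset V :=
  Finset.univ.filter fun u => nextVisit u s ∉ Z

theorem mem_possibleOnes {Z : Finset ℕ} {s : ℕ} {u : V} :
    u ∈ possibleOnes Z s ↔ nextVisit u s ∉ Z := by
  simp [possibleOnes]

theorem mem_possibleOnes_succ {Z : Finset ℕ} {s : ℕ} {u : V} (h : u ≠ scan s) :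
    u ∈ possibleOnes Z (s + 1) ↔ u ∈ possibleOnes Z s := by
  rw [mem_possibleOnes, mem_possibleOnes, nextVisit_succ h]

theorem scan_mem_possibleOnes {Z : Finset ℕ} {s : ℕ} :
    (scan s : V) ∈ possibleOnes Z s ↔ s ∉ Z := by
  rw [mem_possibleOnes, nextVisit_scan]

variable [DecidableEq V] (E : ι → Finset V) (β : ι → ℂ) (A : Finset ι)

/-- The edges at the vertex updated at time `s` all of whose vertices may carry a one. They are the
only ones that can influence the update. -/
noncomputable def activeEdges (Z : Finset ℕ) (s : ℕ) : Finset ι :=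
  A.filter fun i => scan s ∈ E i ∧ E i ⊆ possibleOnes Z s

/-- A set of vertices that determines the pullback through `s` steps of an observable depending
on `R` only, see `pullback_bound`. -/
noncomputable def liveSet (R : Finset V) (Z : Finset ℕ) : ℕ → Finset V
  | 0 => R
  | s + 1 => if scan s ∈ liveSet R Z s then
      (liveSet R Z s).erase (scan s) ∪
        (activeEdges E A Z s).biUnion fun i => (E i).erase (scan s)
      else liveSet R Z s

/-- The times at which the pullback depends nontrivially on the complex transition
probabilities. -/
noncomputable def branchTimes (R : Finset V) (Z : Finset ℕ) (N : ℕ) : Finset ℕ :=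
  (Finset.range N).filter fun s => scan s ∈ liveSet E A R Z s ∧ (activeEdges E A Z s).Nonempty

variable {E β A}

theorem mem_liveSet_succ_of_ne {R : Finset V} {Z : Finset ℕ} {s : ℕ} {u : V}
    (hu : u ∈ liveSet E A R Z s) (hne : u ≠ scan s) : u ∈ liveSet E A R Z (s + 1) := by
  rw [liveSet]
  split_ifs
  · exact Finset.mem_union_left _ (Finset.mem_erase.2 ⟨hne, hu⟩)
  · exact hu

theorem mem_liveSet_succ {R : Finset V} {Z : Finset ℕ} {s : ℕ} {u : V} :
    u ∈ liveSet E A R Z (s + 1) ↔ (u ∈ liveSet E A R Z s ∧ u ≠ scan s) ∨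
      (scan s ∈ liveSet E A R Z s ∧ ∃ i ∈ activeEdges E A Z s, u ∈ E i ∧ u ≠ scan s) := by
  rw [liveSet]
  split_ifs with h
  · simp only [Finset.mem_union, Finset.mem_erase, Finset.mem_biUnion]
    tauto
  · simp only [h, false_and, or_false]
    exact ⟨fun hu => ⟨hu, fun h' => h (h' ▸ hu)⟩, fun hu => hu.1⟩

theorem branchTimes_mono (R : Finset V) (Z : Finset ℕ) {a b : ℕ} (h : a ≤ b) :
    branchTimes E A R Z a ⊆ branchTimes E A R Z b :=
  Finset.filter_subset_filter _ (Finset.range_mono h)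

theorem card_branchTimes_add (R : Finset V) (Z : Finset ℕ) (a b : ℕ) :
    (branchTimes E A R Z (a + b)).card ≤ (branchTimes E A R Z a).card + b := by
  have : branchTimes E A R Z (a + b) ⊆ branchTimes E A R Z a ∪ Finset.Ico a (a + b) := by
    intro s hs
    simp only [branchTimes, Finset.mem_filter, Finset.mem_range, Finset.mem_union,
      Finset.mem_Ico] at hs ⊢
    by_cases h : s < a
    · exact .inl ⟨h, hs.2⟩
    · exact .inr ⟨by omega, hs.1⟩
  calc _ ≤ _ := Finset.card_le_card this
    _ ≤ _ := Finset.card_union_le _ _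
    _ = _ := by simp

theorem card_branchTimes_succ (R : Finset V) (Z : Finset ℕ) (s : ℕ)
    (h : scan s ∈ liveSet E A R Z s) (h' : (activeEdges E A Z s).Nonempty) :
    (branchTimes E A R Z (s + 1)).card = (branchTimes E A R Z s).card + 1 := by
  rw [branchTimes, Finset.range_add_one, Finset.filter_insert, if_pos ⟨h, h'⟩,
    Finset.card_insert_of_notMem (by simp), branchTimes]

theorem flipRatio_eq_of_subset {Z : Finset ℕ} {s : ℕ} {σ : Finset V}
    (hσ : insert (scan s) σ ⊆ possibleOnes Z s) :
    flipRatio E β A (scan s) σ =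
      ∏ i ∈ activeEdges E A Z s with E i ⊆ insert (scan s) σ, β i := by
  rw [flipRatio]
  congr 1
  ext i
  simp only [activeEdges, Finset.mem_filter]
  exact ⟨fun h => ⟨⟨h.1, h.2.1, h.2.2.trans hσ⟩, h.2.2⟩, fun h => ⟨h.1.1, h.1.2.1, h.2⟩⟩

theorem erase_subset_possibleOnes {Z : Finset ℕ} {s : ℕ} {σ : Finset V}
    (hσ : σ ⊆ possibleOnes Z (s + 1)) : σ.erase (scan s) ⊆ possibleOnes Z s := by
  intro u hu
  rw [Finset.mem_erase] at hu
  exact (mem_possibleOnes_succ hu.1).1 (hσ hu.2)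

theorem insert_subset_possibleOnes {Z : Finset ℕ} {s : ℕ} {σ : Finset V} (hs : s ∉ Z)
    (hσ : σ ⊆ possibleOnes Z (s + 1)) : insert (scan s) σ ⊆ possibleOnes Z s := by
  intro u hu
  by_cases h : u = scan s
  · subst h
    exact scan_mem_possibleOnes.2 hs
  · exact (mem_possibleOnes_succ h).1 (hσ ((Finset.mem_insert.1 hu).resolve_left h))

/-- The pullback depends only on the live vertices, and each branching step costs at most a
factor `ρ`. Steps outside `branchTimes` cost nothing: at a vertex that is not live the transition
probabilities sum to one, and without active edges they are genuine probabilities. -/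
theorem pullback_bound {ρ c : ℝ}
    (hB : ∀ v σ, 1 + flipRatio E β A v σ ≠ 0)
    (hBρ : ∀ v σ, ‖1 - flipRatio E β A v σ‖ + 2 * ‖flipRatio E β A v σ‖ ≤
      ρ * ‖1 + flipRatio E β A v σ‖)
    (R : Finset V) (Z : Finset ℕ) (f : Finset V → ℂ)
    (hf : ∀ σ σ', (∀ u ∈ R, u ∈ σ ↔ u ∈ σ') → f σ = f σ')
    (hc : ∀ σ ⊆ possibleOnes Z 0, ‖f σ‖ ≤ c) (s : ℕ) :
    (∀ σ ⊆ possibleOnes Z s, ∀ σ' ⊆ possibleOnes Z s,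
      (∀ u ∈ liveSet E A R Z s, u ∈ σ ↔ u ∈ σ') →
        pullback E β A scan Z f s σ = pullback E β A scan Z f s σ') ∧
    ∀ σ ⊆ possibleOnes Z s,
      ‖pullback E β A scan Z f s σ‖ ≤ c * ρ ^ (branchTimes E A R Z s).card := by
  have hc0 : 0 ≤ c := (norm_nonneg _).trans (hc ∅ (Finset.empty_subset _))
  have hρ : 1 ≤ ρ := by
    have h := hBρ (Classical.arbitrary V) ∅
    have h1 := norm_pos_iff.2 (hB (Classical.arbitrary V) ∅)
    set b := flipRatio E β A (Classical.arbitrary V) ∅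
    have h2 : ‖1 + b‖ ≤ ‖1 - b‖ + 2 * ‖b‖ := by
      calc ‖1 + b‖ = ‖(1 - b) + 2 * b‖ := by ring_nf
        _ ≤ _ := (norm_add_le _ _).trans (by simp)
    by_contra hlt
    nlinarith
  induction s with
  | zero =>
    exact ⟨fun σ _ σ' _ h => hf σ σ' h,
      fun σ hσ => by simpa [pullback, branchTimes] using hc σ hσ⟩
  | succ s ih =>
    obtain ⟨ih1, ih2⟩ := ih
    have hpow : c * ρ ^ (branchTimes E A R Z s).card ≤
        c * ρ ^ (branchTimes E A R Z (s + 1)).card :=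
      mul_le_mul_of_nonneg_left (pow_le_pow_right₀ hρ
        (Finset.card_le_card (branchTimes_mono R Z (Nat.le_succ s)))) hc0
    have herase : ∀ σ ⊆ possibleOnes Z (s + 1), ∀ σ' ⊆ possibleOnes Z (s + 1),
        (∀ u ∈ liveSet E A R Z (s + 1), u ∈ σ ↔ u ∈ σ') →
        pullback E β A scan Z f s (σ.erase (scan s)) =
          pullback E β A scan Z f s (σ'.erase (scan s)) := by
      intro σ hσ σ' hσ' h
      refine ih1 _ (erase_subset_possibleOnes hσ) _ (erase_subset_possibleOnes hσ') ?_
      intro u hu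
      simp only [Finset.mem_erase, ne_eq, and_congr_right_iff]
      exact fun hne => h u (mem_liveSet_succ_of_ne hu hne)
    by_cases hs : s ∈ Z
    · simp only [pullback, if_pos hs]
      exact ⟨herase, fun σ hσ => (ih2 _ (erase_subset_possibleOnes hσ)).trans hpow⟩
    simp only [pullback, if_neg hs]
    by_cases hl : scan s ∈ liveSet E A R Z s
    · constructor
      · intro σ hσ σ' hσ' h
        have hins : pullback E β A scan Z f s (insert (scan s) σ) =
            pullback E β A scan Z f s (insert (scan s) σ') := by
          refine ih1 _ (insert_subset_possibleOnes hs hσ) _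
            (insert_subset_possibleOnes hs hσ') ?_
          intro u hu
          simp only [Finset.mem_insert]
          by_cases hne : u = scan s
          · simp [hne]
          · simp only [hne, false_or]
            exact h u (mem_liveSet_succ_of_ne hu hne)
        have hflip : flipRatio E β A (scan s) σ = flipRatio E β A (scan s) σ' := by
          rw [flipRatio_eq_of_subset (insert_subset_possibleOnes hs hσ),
            flipRatio_eq_of_subset (insert_subset_possibleOnes hs hσ')]
          congr 1
          refine Finset.filter_congr fun i hi => ?_
          refine forall₂_congr fun u hu => ?_
          simp only [Finset.mem_insert]
          by_cases hne : u = scan s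
          · simp [hne]
          · simp only [hne, false_or]
            exact h u (mem_liveSet_succ.2 (.inr ⟨hl, i, hi, hu, hne⟩))
        simp only [lazyStep, herase σ hσ σ' hσ' h, hins, hflip]
      · intro σ hσ
        have h1 := ih2 _ (erase_subset_possibleOnes hσ)
        have h2 := ih2 _ (insert_subset_possibleOnes hs hσ)
        rw [lazyStep]
        by_cases ha : (activeEdges E A Z s).Nonempty
        · rw [card_branchTimes_succ R Z s hl ha, pow_succ, ← mul_assoc]
          set b := flipRatio E β A (scan s) σ
          set M := c * ρ ^ (branchTimes E A R Z s).card
          have hb : 0 < ‖1 + b‖ := norm_pos_iff.2 (hB _ _)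
          have hM : 0 ≤ M := (norm_nonneg _).trans h1
          calc _ ≤ ‖(1 - b) / (1 + b)‖ * M + ‖2 * b / (1 + b)‖ * M := by
                refine (norm_add_le _ _).trans ?_
                rw [norm_mul, norm_mul]
                gcongr
            _ = M * ((‖1 - b‖ + 2 * ‖b‖) / ‖1 + b‖) := by
                rw [norm_div, norm_div, norm_mul]
                simp only [Complex.norm_ofNat]
                ring
            _ ≤ M * ρ := by
                gcongr
                rw [div_le_iff₀ hb]
                exact hBρ _ _
        · have hb : flipRatio E β A (scan s) σ = 1 := by
            rw [flipRatio_eq_of_subset (insert_subset_possibleOnes hs hσ),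
              Finset.not_nonempty_iff_eq_empty.1 ha]
            simp
          rw [hb]
          norm_num
          exact h2.trans hpow
    -- At a vertex that is not live both values give the same pullback.
    · have hlazy : ∀ σ ⊆ possibleOnes Z (s + 1),
          lazyStep E β A (scan s) (pullback E β A scan Z f s) σ =
            pullback E β A scan Z f s (σ.erase (scan s)) := by
        intro σ hσ
        have hins : pullback E β A scan Z f s (insert (scan s) σ) =
            pullback E β A scan Z f s (σ.erase (scan s)) := by
          refine ih1 _ (insert_subset_possibleOnes hs hσ) _ (erase_subset_possibleOnes hσ) ?_
          intro u hu
          have hne : u ≠ scan s := fun h => hl (h ▸ hu)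
          simp [hne]
        rw [lazyStep, hins, ← add_mul, ← add_div]
        have h0 := hB (scan s) σ
        rw [show 1 - flipRatio E β A (scan s) σ + 2 * flipRatio E β A (scan s) σ =
          1 + flipRatio E β A (scan s) σ by ring, div_self h0, one_mul]
      refine ⟨fun σ hσ σ' hσ' h => ?_, fun σ hσ => ?_⟩
      · rw [hlazy σ hσ, hlazy σ' hσ']
        exact herase σ hσ σ' hσ' h
      · rw [hlazy σ hσ]
        exact (ih2 _ (erase_subset_possibleOnes hσ)).trans hpow

theorem liveSet_eq_empty_of_le {R : Finset V} {Z : Finset ℕ} {a b : ℕ} (hab : a ≤ b)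
    (h : liveSet E A R Z a = ∅) : liveSet E A R Z b = ∅ := by
  induction b, hab using Nat.le_induction with
  | base => exact h
  | succ b _ ih => simp [liveSet, ih]

theorem branchTimes_eq_of_liveSet_eq_empty {R : Finset V} {Z : Finset ℕ} {a b : ℕ} (hab : a ≤ b)
    (h : liveSet E A R Z a = ∅) : branchTimes E A R Z b = branchTimes E A R Z a := by
  refine (Finset.Subset.antisymm (branchTimes_mono R Z hab) fun s hs => ?_).symm
  simp only [branchTimes, Finset.mem_filter, Finset.mem_range] at hs ⊢
  refine ⟨?_, hs.2⟩
  by_contra hlt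
  have h0 := liveSet_eq_empty_of_le (not_lt.1 hlt) h
  rw [h0] at hs
  simp at hs

/-- Each vertex is updated once per sweep, so the live set dies out in a sweep without branching
times. -/
theorem liveSet_eq_empty_of_sweep {R : Finset V} {Z : Finset ℕ} {a : ℕ}
    (h : ∀ s, a ≤ s → s < a + Fintype.card V →
      scan s ∈ liveSet E A R Z s → ¬ (activeEdges E A Z s).Nonempty) :
    liveSet E A R Z (a + Fintype.card V) = ∅ := by
  have key : ∀ j ≤ Fintype.card V, ∀ u ∈ liveSet E A R Z (a + j),
      ∀ t, a ≤ t → t < a + j → scan t ≠ u := by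
    intro j
    induction j with
    | zero => intro _ u _ t h1 h2; omega
    | succ j ih =>
      intro hj u hu t h1 h2
      rw [← add_assoc, mem_liveSet_succ] at hu
      rcases hu with ⟨hu, hne⟩ | ⟨hl, i, hi, -⟩
      · rcases Nat.lt_succ_iff_lt_or_eq.1 (show t < (a + j) + 1 by omega) with h3 | rfl
        · exact ih (by omega) u hu t h1 h3
        · exact hne.symm
      · exact absurd ⟨i, hi⟩ (h (a + j) (by omega) (by omega) hl)
  refine Finset.eq_empty_of_forall_notMem fun u hu => ?_
  obtain ⟨t, h1, h2, h3⟩ := exists_scan_eq u a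
  exact key _ le_rfl u hu t h1 h2 h3

theorem le_card_branchTimes {R : Finset V} {Z : Finset ℕ} (m : ℕ)
    (h : (liveSet E A R Z (m * Fintype.card V)).Nonempty) :
    m ≤ (branchTimes E A R Z (m * Fintype.card V)).card := by
  induction m with
  | zero => exact Nat.zero_le _
  | succ m ih =>
    rw [Nat.succ_mul] at h ⊢
    have h0 : (liveSet E A R Z (m * Fintype.card V)).Nonempty := by
      rw [Finset.nonempty_iff_ne_empty] at h ⊢
      exact fun h' => h (liveSet_eq_empty_of_le (Nat.le_add_right _ _) h')
    refine (Nat.succ_le_succ (ih h0)).trans (Finset.card_lt_card ?_)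
    refine Finset.ssubset_iff_subset_ne.2 ⟨branchTimes_mono R Z (Nat.le_add_right _ _), ?_⟩
    intro heq
    refine h.ne_empty (liveSet_eq_empty_of_sweep fun s h1 h2 h3 h4 => ?_)
    have hs : s ∈ branchTimes E A R Z (m * Fintype.card V + Fintype.card V) :=
      Finset.mem_filter.2 ⟨Finset.mem_range.2 h2, h3, h4⟩
    rw [← heq] at hs
    have := Finset.mem_range.1 (Finset.mem_filter.1 hs).1
    omega

end LiveSet

/-! ### Space-time windows -/

section Windows

variable {V ι : Type*} [Fintype V] [Nonempty V]

theorem disjoint_image_nextVisit {Z : Finset ℕ} {e : Finset V} {s : ℕ} :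
    Disjoint (e.image fun u => nextVisit u s) Z ↔ e ⊆ possibleOnes Z s := by
  simp only [Finset.disjoint_left, Finset.mem_image, forall_exists_index, and_imp,
    forall_apply_eq_imp_iff₂, Finset.subset_iff, mem_possibleOnes]

variable [DecidableEq V] (E : ι → Finset V) (A : Finset ι)

/-- The sites of the percolation in space-time. The window `some (i, s)` consists of the most recent
updates, seen from time `s`, of the vertices of the edge `E i`; the window `none` is the one of the
set `R` at time `0`. -/
noncomputable def windowPoints (R : Finset V) : Option (ι × ℕ) → Finset ℕ
  | none => R.image fun u => nextVisit u 0
  | some w => (E w.1).image fun u => nextVisit u w.2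

/-- The windows that begin with an update before time `S`, and the window at time `0`. -/
noncomputable def windows (S : ℕ) : Finset (Option (ι × ℕ)) :=
  Finset.insertNone ((A ×ˢ Finset.range S).filter fun w => scan w.2 ∈ E w.1)

variable {E A}

theorem some_mem_windows {S : ℕ} {w : ι × ℕ} :
    some w ∈ windows E A S ↔ w.1 ∈ A ∧ w.2 < S ∧ scan w.2 ∈ E w.1 := by
  simp [windows, and_assoc]

theorem none_mem_windows (S : ℕ) : none ∈ windows E A S := by
  simp [windows]

theorem card_windowPoints {R : Finset V} {k S : ℕ} (hR : R.card = k)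
    (hE : ∀ i ∈ A, (E i).card = k) (j : Option (ι × ℕ)) (hj : j ∈ windows E A S) :
    (windowPoints E R j).card = k := by
  cases j with
  | none => rw [windowPoints, Finset.card_image_of_injective _ (nextVisit_injective 0), hR]
  | some w =>
    rw [windowPoints, Finset.card_image_of_injective _ (nextVisit_injective w.2),
      hE _ (some_mem_windows.1 hj).1]

theorem windowPoints_subset_range (R : Finset V) {S : ℕ} (j : Option (ι × ℕ))
    (hj : j ∈ windows E A S) :
    windowPoints E R j ⊆ Finset.range (S + Fintype.card V) := by
  cases j with
  | none =>
    intro p hp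
    obtain ⟨u, -, rfl⟩ := Finset.mem_image.1 hp
    have := nextVisit_lt u 0
    exact Finset.mem_range.2 (by omega)
  | some w =>
    intro p hp
    obtain ⟨u, -, rfl⟩ := Finset.mem_image.1 hp
    have := nextVisit_lt u w.2
    have := (some_mem_windows.1 hj).2.1
    exact Finset.mem_range.2 (by omega)

/-- A window of the edge `E i` containing the time `p` is determined by its first time, which lies
in the sweep ending at `p` and is an update of one of the `k` vertices of `E i`. -/
theorem card_windows_containing {k Δ : ℕ} (S : ℕ) (R : Finset V)
    (hE : ∀ i ∈ A, (E i).card = k) (hdeg : ∀ v, (A.filter fun i => v ∈ E i).card ≤ Δ) (p : ℕ) :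
    (((A ×ˢ Finset.range S).filter fun w => scan w.2 ∈ E w.1).filter
      fun w => p ∈ windowPoints E R (some w)).card ≤ Δ * k := by
  classical
  set T : ι → Finset ℕ := fun i => (Finset.range (p + 1)).filter
    fun s => p < s + Fintype.card V ∧ scan s ∈ E i with hT
  have hTcard : ∀ i ∈ A, (T i).card ≤ k := by
    intro i hi
    rw [← hE i hi]
    refine Finset.card_le_card_of_injOn (fun s => (scan s : V)) ?_ ?_
    · intro s hs
      exact (Finset.mem_filter.1 hs).2.2
    · intro s hs t ht hst
      simp only [hT, Finset.coe_filter, Finset.mem_range, Set.mem_ofPred_eq] at hs ht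
      exact scan_injOn hst (Nat.lt_succ_iff.1 hs.1) hs.2.1 (Nat.lt_succ_iff.1 ht.1) ht.2.1
  calc _ ≤ ((A.filter fun i => scan p ∈ E i).biUnion fun i => (T i).image (Prod.mk i)).card := by
        refine Finset.card_le_card ?_
        rintro ⟨i, s⟩ hw
        simp only [Finset.mem_filter, Finset.mem_product, Finset.mem_range, windowPoints,
          Finset.mem_image] at hw
        obtain ⟨⟨⟨hi, -⟩, hs⟩, u, hu, rfl⟩ := hw
        simp only [hT, Finset.mem_biUnion, Finset.mem_filter, Finset.mem_image, Finset.mem_range,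
          scan_nextVisit]
        exact ⟨i, ⟨hi, hu⟩, s, ⟨Nat.lt_succ_of_le (le_nextVisit u s), nextVisit_lt u s, hs⟩, rfl⟩
    _ ≤ (A.filter fun i => scan p ∈ E i).card * k := by
        refine Finset.card_biUnion_le_card_mul _ _ _ fun i hi => ?_
        exact Finset.card_image_le.trans (hTcard i (Finset.mem_filter.1 hi).1)
    _ ≤ Δ * k := Nat.mul_le_mul_right _ (hdeg _)

theorem card_meeting_windows {k Δ : ℕ} (S : ℕ) {R : Finset V} (hR : R.card = k)
    (hE : ∀ i ∈ A, (E i).card = k) (hdeg : ∀ v, (A.filter fun i => v ∈ E i).card ≤ Δ)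
    (j : Option (ι × ℕ)) (hj : j ∈ windows E A S) :
    (meeting (windowPoints E R) (windows E A S) j).card ≤ k * (Δ * k) + 1 := by
  classical
  set W := (A ×ˢ Finset.range S).filter fun w => scan w.2 ∈ E w.1 with hW
  calc _ ≤ (Finset.insertNone ((windowPoints E R j).biUnion fun p =>
          W.filter fun w => p ∈ windowPoints E R (some w))).card := by
        refine Finset.card_le_card fun j' hj' => ?_
        rw [meeting, Finset.mem_filter, Finset.not_disjoint_iff] at hj'
        obtain ⟨h1, p, hp, hp'⟩ := hj'
        rw [Finset.mem_insertNone]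
        rintro w rfl
        exact Finset.mem_biUnion.2 ⟨p, hp, Finset.mem_filter.2
          ⟨Finset.mem_insertNone.1 h1 w rfl, hp'⟩⟩
    _ ≤ _ := by
        rw [Finset.card_insertNone]
        refine Nat.add_le_add_right ?_ 1
        rw [← card_windowPoints hR hE j hj]
        refine Finset.card_biUnion_le_card_mul _ _ _ fun p _ => ?_
        rw [card_windowPoints hR hE j hj]
        exact card_windows_containing S R hE hdeg p

/-- The most recent update of a live vertex lies in an open window connected to the window at
time `0`. -/
theorem exists_mem_openCluster_of_mem_liveSet {R : Finset V} {Z : Finset ℕ} {S : ℕ}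
    (hR : R ⊆ possibleOnes Z 0) (s : ℕ) (hs : s ≤ S) :
    ∀ u ∈ liveSet E A R Z s, ∃ j ∈ openCluster (windowPoints E R) Z (windows E A S) {none},
      nextVisit u s ∈ windowPoints E R j := by
  induction s with
  | zero =>
    intro u hu
    refine ⟨none, ?_, Finset.mem_image_of_mem _ hu⟩
    rw [mem_openCluster]
    exact .seed (Finset.mem_singleton_self _) (none_mem_windows S)
      (disjoint_image_nextVisit.2 hR)
  | succ s ih =>
    intro u hu
    have ih := ih (by omega)
    rcases mem_liveSet_succ.1 hu with ⟨hu, hne⟩ | ⟨hl, i, hi, hui, hne⟩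
    · rw [nextVisit_succ hne]
      exact ih u hu
    · obtain ⟨j, hj, hjs⟩ := ih _ hl
      rw [nextVisit_scan] at hjs
      obtain ⟨hiA, hsi, hopen⟩ := Finset.mem_filter.1 hi
      refine ⟨some (i, s), ?_, ?_⟩
      · rw [mem_openCluster] at hj ⊢
        refine .step hj (some_mem_windows.2 ⟨hiA, by omega, hsi⟩)
          (disjoint_image_nextVisit.2 hopen) (Finset.not_disjoint_iff.2 ⟨s, hjs, ?_⟩)
        exact Finset.mem_image.2 ⟨scan s, hsi, nextVisit_scan s⟩
      · rw [nextVisit_succ hne]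
        exact Finset.mem_image_of_mem _ hui

theorem card_branchTimes_le_card_openCluster {R : Finset V} {Z : Finset ℕ} {S : ℕ}
    (hR : R ⊆ possibleOnes Z 0) :
    (branchTimes E A R Z S).card ≤
      (openCluster (windowPoints E R) Z (windows E A S) {none}).card := by
  refine (Finset.card_le_card ?_).trans
    (Finset.card_image_le (f := fun j : Option (ι × ℕ) => j.elim 0 Prod.snd))
  intro s hs
  obtain ⟨hsS, hl, i, hi⟩ := Finset.mem_filter.1 hs
  rw [Finset.mem_range] at hsS
  obtain ⟨j, hj, hjs⟩ := exists_mem_openCluster_of_mem_liveSet hR s hsS.le _ hl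
  rw [nextVisit_scan] at hjs
  obtain ⟨hiA, hsi, hopen⟩ := Finset.mem_filter.1 hi
  refine Finset.mem_image.2 ⟨some (i, s), ?_, rfl⟩
  rw [mem_openCluster] at hj ⊢
  refine .step hj (some_mem_windows.2 ⟨hiA, hsS, hsi⟩) (disjoint_image_nextVisit.2 hopen)
    (Finset.not_disjoint_iff.2 ⟨s, hjs, ?_⟩)
  exact Finset.mem_image.2 ⟨scan s, hsi, nextVisit_scan s⟩

/-- If the partition function does not vanish, the complex probability that all of `R` is one is
small. The dynamics is run over `m` sweeps followed by one more sweep, with `m` so large that the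
coins for which the initial configuration still matters contribute no more than the others. -/
theorem norm_sum_configWeight_le {β : ι → ℂ} {k Δ : ℕ} (hk : 0 < k) {R : Finset V}
    (hR : R.card = k) (hE : ∀ i ∈ A, (E i).card = k)
    (hdeg : ∀ v, (A.filter fun i => v ∈ E i).card ≤ Δ) {ρ z y : ℝ} (hρ : 1 ≤ ρ) (hρz : ρ < z)
    (hB : ∀ v σ, 1 + flipRatio E β A v σ ≠ 0)
    (hBρ : ∀ v σ, ‖1 - flipRatio E β A v σ‖ + 2 * ‖flipRatio E β A v σ‖ ≤
      ρ * ‖1 + flipRatio E β A v σ‖) (hy : 0 ≤ y)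
    (hzy : z ^ (k * (Δ * k) + 1) * (1 / 2) ^ k * (1 + y) ^ (k * (Δ * k) + 1) ^ 2 ≤ y)
    (hZ : ∑ σ, configWeight E β A σ ≠ 0) :
    ‖∑ σ with R ⊆ σ, configWeight E β A σ‖ ≤
      ‖∑ σ, configWeight E β A σ‖ * (y + (1 / 2) ^ k) := by
  classical
  have hρ0 : 0 < ρ := by linarith
  have hz0 : 0 < z := by linarith
  set n := Fintype.card V with hn
  set W₁ := ∑ σ, ‖configWeight E β A σ‖ with hW₁
  set Q := ‖∑ σ, configWeight E β A σ‖ with hQ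
  have hQ0 : 0 < Q := norm_pos_iff.2 hZ
  have hQW : Q ≤ W₁ := norm_sum_le _ _
  have hW0 : 0 < W₁ := hQ0.trans_le hQW
  obtain ⟨m, hm⟩ : ∃ m : ℕ, (ρ / z) ^ m < Q / (W₁ * ρ ^ n) :=
    exists_pow_lt_of_lt_one (by positivity) (by rwa [div_lt_one hz0])
  have hm' : ∀ r, m ≤ r → W₁ * ρ ^ (r + n) ≤ Q * z ^ r := by
    intro r hr
    have h1 : (ρ / z) ^ r ≤ Q / (W₁ * ρ ^ n) :=
      (pow_le_pow_of_le_one (by positivity) ((div_le_one hz0).2 hρz.le) hr).trans hm.le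
    rw [div_pow, div_le_div_iff₀ (by positivity) (by positivity)] at h1
    calc _ = ρ ^ r * (W₁ * ρ ^ n) := by rw [pow_add]; ring
      _ ≤ _ := h1
  set S := m * n with hS
  set f : Finset V → ℂ := fun σ => if R ⊆ σ then 1 else 0 with hf
  set C : Finset ℕ → Finset (Option (ι × ℕ)) := fun Z =>
    openCluster (windowPoints E R) Z (windows E A S) {none} with hC
  have hterm : ∀ Z ∈ (Finset.range (S + n)).powerset,
      ‖∑ σ, configWeight E β A σ * pullback E β A scan Z f (S + n) σ‖ ≤
        if Disjoint (windowPoints E R none) Z then Q * z ^ (C Z).card else 0 := by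
    intro Z hZN
    have hall : ∀ σ : Finset V, σ ⊆ possibleOnes Z (S + n) := fun σ u _ => by
      rw [mem_possibleOnes]
      intro h
      have h1 := Finset.mem_range.1 (Finset.mem_powerset.1 hZN h)
      have h2 := le_nextVisit u (S + n)
      omega
    obtain ⟨hconst, hbound⟩ := pullback_bound hB hBρ R Z f
      (c := if Disjoint (windowPoints E R none) Z then 1 else 0)
      (fun σ σ' h => by
        have : R ⊆ σ ↔ R ⊆ σ' := forall₂_congr fun u hu => h u hu
        simp only [hf, this])
      (fun σ hσ => by
        by_cases hRσ : R ⊆ σ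
        · have hd : Disjoint (windowPoints E R none) Z :=
            disjoint_image_nextVisit.2 (hRσ.trans hσ)
          simp [hf, hRσ, hd]
        · simp only [hf, hRσ, if_false, norm_zero]
          split_ifs <;> norm_num) (S + n)
    by_cases hd : Disjoint (windowPoints E R none) Z
    · simp only [if_pos hd, one_mul] at hbound ⊢
      have hcl : (branchTimes E A R Z S).card ≤ (C Z).card :=
        card_branchTimes_le_card_openCluster (disjoint_image_nextVisit.1 hd)
      have hzC : z ^ (branchTimes E A R Z S).card ≤ z ^ (C Z).card :=
        pow_le_pow_right₀ (by linarith) hcl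
      rcases (liveSet E A R Z S).eq_empty_or_nonempty with hl | hl
      · have hempty := liveSet_eq_empty_of_le (Nat.le_add_right S n) hl
        have hc : ∀ σ, pullback E β A scan Z f (S + n) σ =
            pullback E β A scan Z f (S + n) ∅ := fun σ =>
          hconst σ (hall σ) ∅ (hall ∅) (by simp [hempty])
        simp only [hc]
        rw [← Finset.sum_mul, norm_mul]
        refine mul_le_mul_of_nonneg_left ((hbound ∅ (hall ∅)).trans ?_) hQ0.le
        rw [branchTimes_eq_of_liveSet_eq_empty (Nat.le_add_right S n) hl]
        exact (pow_le_pow_left₀ hρ0.le hρz.le _).trans hzC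
      · calc _ ≤ ∑ σ, ‖configWeight E β A σ‖ * ρ ^ ((branchTimes E A R Z S).card + n) := by
              refine (norm_sum_le _ _).trans (Finset.sum_le_sum fun σ _ => ?_)
              rw [norm_mul]
              refine mul_le_mul_of_nonneg_left ((hbound σ (hall σ)).trans ?_) (norm_nonneg _)
              exact pow_le_pow_right₀ hρ (card_branchTimes_add R Z S n)
          _ ≤ Q * z ^ (branchTimes E A R Z S).card := by
              rw [← Finset.sum_mul]
              exact hm' _ (le_card_branchTimes m hl)
          _ ≤ _ := mul_le_mul_of_nonneg_left hzC hQ0.le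
    · simp only [if_neg hd, zero_mul] at hbound ⊢
      have h0 : ∀ σ, pullback E β A scan Z f (S + n) σ = 0 := fun σ =>
        norm_le_zero_iff.1 (hbound σ (hall σ))
      simp [h0]
  have hperc := sum_openCluster_singleton_le (windowPoints E R) k (k * (Δ * k) + 1) hk z y
    (by linarith) hy hzy (windows E A S) (Finset.range (S + n))
    (windowPoints_subset_range R) (card_windowPoints hR hE) (card_meeting_windows S hR hE hdeg)
    none (none_mem_windows S)
  rw [Finset.card_range] at hperc
  have hmain := congrArg norm (sum_pullback E β A scan f hB (S + n))
  have hsumf : ∑ σ, configWeight E β A σ * f σ = ∑ σ with R ⊆ σ, configWeight E β A σ := by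
    simp [hf, Finset.sum_filter]
  rw [norm_mul, norm_pow, Complex.norm_ofNat, hsumf] at hmain
  refine le_of_mul_le_mul_left ?_ (show (0 : ℝ) < 2 ^ (S + n) by positivity)
  rw [← hmain]
  calc _ ≤ ∑ Z ∈ (Finset.range (S + n)).powerset,
          if Disjoint (windowPoints E R none) Z then Q * z ^ (C Z).card else 0 :=
        (norm_sum_le _ _).trans (Finset.sum_le_sum hterm)
    _ = Q * ∑ Z ∈ (Finset.range (S + n)).powerset with Disjoint (windowPoints E R none) Z,
          z ^ (C Z).card := by rw [← Finset.sum_filter, Finset.mul_sum]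
    _ ≤ Q * (2 ^ (S + n) * (y + (1 / 2) ^ k)) := mul_le_mul_of_nonneg_left hperc hQ0.le
    _ = _ := by ring

end Windows

/-! ### Zero-freeness -/

section ZeroFreeness

theorem exists_norm_prod_sub_le {ι : Type*} {ε : ℝ} (hε : 0 ≤ ε) (β : ι → ℂ)
    (hβ : ∀ i, β i ∈ unitSegmentNhd ε) (A : Finset ι) :
    ∃ b ∈ Set.Icc (0 : ℝ) 1, ‖∏ i ∈ A, β i - (b : ℂ)‖ ≤ (1 + ε) ^ A.card - 1 := by
  classical
  induction A using Finset.induction_on with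
  | empty => exact ⟨1, by simp, by simp⟩
  | insert i A hi ih =>
    obtain ⟨b, hb, h⟩ := ih
    obtain ⟨c, hc, h'⟩ := hβ i
    refine ⟨c * b, ⟨mul_nonneg hc.1 hb.1, mul_le_one₀ hc.2 hb.1 hb.2⟩, ?_⟩
    rw [Finset.prod_insert hi, Finset.card_insert_of_notMem hi]
    set B := ∏ i ∈ A, β i
    have hβi : ‖β i‖ ≤ 1 + ε := by
      calc ‖β i‖ = ‖(c : ℂ) + (β i - c)‖ := by ring_nf
        _ ≤ ‖(c : ℂ)‖ + ‖β i - c‖ := norm_add_le _ _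
        _ ≤ 1 + ε := by
          rw [Complex.norm_of_nonneg hc.1]
          exact add_le_add hc.2 h'
    calc ‖β i * B - ((c * b : ℝ) : ℂ)‖ = ‖β i * (B - b) + b * (β i - c)‖ := by
          push_cast; ring_nf
      _ ≤ ‖β i‖ * ‖B - b‖ + ‖(b : ℂ)‖ * ‖β i - c‖ := by
          rw [← norm_mul, ← norm_mul]; exact norm_add_le _ _
      _ ≤ (1 + ε) * ((1 + ε) ^ A.card - 1) + 1 * ε := by
          rw [Complex.norm_of_nonneg hb.1]
          gcongr
          exact hb.2
      _ = _ := by ring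

/-- Near a real flip ratio in `[0, 1]` the total variation of `lazyStep` is close to one. -/
theorem norm_one_sub_add_le {B : ℂ} {b η : ℝ} (hb : b ∈ Set.Icc (0 : ℝ) 1) (hη : η ≤ 1 / 2)
    (h : ‖B - b‖ ≤ η) :
    1 + B ≠ 0 ∧ ‖1 - B‖ + 2 * ‖B‖ ≤ (1 + 8 * η) * ‖1 + B‖ := by
  have hη0 : 0 ≤ η := (norm_nonneg _).trans h
  have h1 : ‖1 - B‖ ≤ (1 - b) + η := by
    calc ‖1 - B‖ = ‖((1 - b : ℝ) : ℂ) - (B - b)‖ := by push_cast; ring_nf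
      _ ≤ ‖((1 - b : ℝ) : ℂ)‖ + ‖B - b‖ := norm_sub_le _ _
      _ ≤ _ := by rw [Complex.norm_of_nonneg (by linarith [hb.2])]; linarith
  have h2 : ‖B‖ ≤ b + η := by
    calc ‖B‖ = ‖(b : ℂ) + (B - b)‖ := by ring_nf
      _ ≤ ‖(b : ℂ)‖ + ‖B - b‖ := norm_add_le _ _
      _ ≤ _ := by rw [Complex.norm_of_nonneg hb.1]; linarith
  have h3 : 1 + b - η ≤ ‖1 + B‖ := by
    have : ‖((1 + b : ℝ) : ℂ)‖ ≤ ‖1 + B‖ + ‖B - b‖ := by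
      calc ‖((1 + b : ℝ) : ℂ)‖ = ‖(1 + B) - (B - b)‖ := by push_cast; ring_nf
        _ ≤ _ := norm_sub_le _ _
    rw [Complex.norm_of_nonneg (by linarith [hb.1])] at this
    linarith
  refine ⟨norm_pos_iff.1 (by linarith [hb.1]), ?_⟩
  calc ‖1 - B‖ + 2 * ‖B‖ ≤ 1 + b + 3 * η := by linarith
    _ ≤ (1 + 8 * η) * (1 + b - η) := by nlinarith [hb.1, mul_nonneg hη0 hb.1]
    _ ≤ _ := by gcongr

variable {V ι : Type*} [DecidableEq V] {E : ι → Finset V} {A : Finset ι}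

theorem flipRatio_bound {β : ι → ℂ} {Δ : ℕ} {ε : ℝ} (hε : 0 ≤ ε) (hΔε : 4 * (Δ * ε) ≤ 1)
    (hβ : ∀ i, β i ∈ unitSegmentNhd ε)
    (hdeg : ∀ v, (A.filter fun i => v ∈ E i).card ≤ Δ) (v : V) (σ : Finset V) :
    1 + flipRatio E β A v σ ≠ 0 ∧
      ‖1 - flipRatio E β A v σ‖ + 2 * ‖flipRatio E β A v σ‖ ≤
        (1 + 16 * (Δ * ε)) * ‖1 + flipRatio E β A v σ‖ := by
  have hΔε0 : 0 ≤ Δ * ε := by positivity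
  obtain ⟨b, hb, h⟩ := exists_norm_prod_sub_le hε β hβ
    (A.filter fun i => v ∈ E i ∧ E i ⊆ insert v σ)
  have hcard : (A.filter fun i => v ∈ E i ∧ E i ⊆ insert v σ).card ≤ Δ :=
    (Finset.card_le_card (Finset.monotone_filter_right A fun i _ hi => hi.1)).trans (hdeg v)
  have hη : ‖flipRatio E β A v σ - b‖ ≤ 2 * (Δ * ε) := by
    refine h.trans ?_
    have h1 : (1 + ε) ^ (A.filter fun i => v ∈ E i ∧ E i ⊆ insert v σ).card ≤
        Real.exp (Δ * ε) := by
      calc _ ≤ (1 + ε) ^ Δ := pow_le_pow_right₀ (by linarith) hcard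
        _ ≤ Real.exp ε ^ Δ :=
          pow_le_pow_left₀ (by linarith) (by linarith [Real.add_one_le_exp ε]) _
        _ = _ := (Real.exp_nat_mul ε Δ).symm
    have h2 := Real.abs_exp_sub_one_le (x := Δ * ε) (by rw [abs_of_nonneg hΔε0]; linarith)
    rw [abs_of_nonneg hΔε0] at h2
    linarith [le_abs_self (Real.exp (Δ * ε) - 1)]
  have := norm_one_sub_add_le hb (by linarith) hη
  rwa [show 8 * (2 * (Δ * ε)) = 16 * (Δ * ε) by ring] at this

theorem sum_configWeight_insert [Fintype V] [DecidableEq ι] (β : ι → ℂ) {i : ι} (hi : i ∉ A) :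
    ∑ σ, configWeight E β (insert i A) σ = ∑ σ, configWeight E β A σ +
      (β i - 1) * ∑ σ with E i ⊆ σ, configWeight E β A σ := by
  rw [Finset.sum_filter, Finset.mul_sum, ← Finset.sum_add_distrib]
  refine Finset.sum_congr rfl fun σ _ => ?_
  rw [configWeight, Finset.filter_insert]
  split_ifs with h
  · rw [Finset.prod_insert (by simp [hi])]
    simp only [configWeight]
    ring
  · simp [configWeight]

/-- The choice `z = 1 + 1 / D` and `y = e ^ 2 * 2 ^ (-k)` in the percolation estimate. -/
theorem percolation_parameters {D k : ℕ} (hD : 0 < D)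
    (h : Real.exp 1 ^ 2 * (1 / 2) ^ k * (D : ℝ) ^ 2 ≤ 1) :
    (1 + 1 / (D : ℝ)) ^ D * (1 / 2) ^ k * (1 + Real.exp 1 ^ 2 * (1 / 2) ^ k) ^ D ^ 2 ≤
      Real.exp 1 ^ 2 * (1 / 2) ^ k := by
  have hD' : (0 : ℝ) < D := by exact_mod_cast hD
  have key : ∀ (x : ℝ) (m : ℕ), 0 ≤ x → x * m ≤ 1 → (1 + x) ^ m ≤ Real.exp 1 := by
    intro x m hx hxm
    calc (1 + x) ^ m ≤ Real.exp x ^ m :=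
          pow_le_pow_left₀ (by linarith) (by linarith [Real.add_one_le_exp x]) _
      _ = Real.exp (m * x) := (Real.exp_nat_mul x m).symm
      _ ≤ _ := Real.exp_le_exp.2 (by linarith)
  have h1 := key (1 / D) D (by positivity) (by rw [one_div_mul_cancel hD'.ne'])
  have h2 := key (Real.exp 1 ^ 2 * (1 / 2) ^ k) (D ^ 2) (by positivity) (by exact_mod_cast h)
  calc _ ≤ Real.exp 1 * (1 / 2) ^ k * Real.exp 1 := by gcongr
    _ = _ := by ring

/-- Adding the edge `E i` multiplies the partition function by `1 + (β i - 1) * μ (E i ⊆ σ)`, where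
`μ` is the complex Gibbs measure without that edge; this factor is nonzero because
`|β i - 1| ≤ 2` and the complex probability is at most `1 / 4` in absolute value. -/
theorem sum_configWeight_ne_zero [Fintype V] {β : ι → ℂ} {k Δ : ℕ} {ε : ℝ} (hk : 0 < k)
    (hε : 0 ≤ ε) (hεD : 16 * (Δ * ε) * ((k * (Δ * k) + 1 : ℕ) : ℝ) < 1)
    (hε1 : ε ≤ 1)
    (hcond : Real.exp 1 ^ 2 * (1 / 2) ^ k * (((k * (Δ * k) + 1 : ℕ) : ℝ)) ^ 2 ≤ 1 / 8)
    (hβ : ∀ i, β i ∈ unitSegmentNhd ε) (hE : ∀ i ∈ A, (E i).card = k)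
    (hdeg : ∀ v, (A.filter fun i => v ∈ E i).card ≤ Δ) :
    ∑ σ, configWeight E β A σ ≠ 0 := by
  classical
  set D := k * (Δ * k) + 1 with hD
  have hD0 : (0 : ℝ) < D := by positivity
  have hD1 : (1 : ℝ) ≤ D := by exact_mod_cast Nat.succ_le_of_lt (Nat.succ_pos _)
  have hΔε0 : 0 ≤ Δ * ε := by positivity
  have hΔε : 16 * (Δ * ε) < 1 := by nlinarith
  induction A using Finset.induction_on with
  | empty =>
    simp [configWeight]
  | insert i A hi ih =>
    have hE' : ∀ j ∈ A, (E j).card = k := fun j hj => hE j (Finset.mem_insert_of_mem hj)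
    have hdeg' : ∀ v, (A.filter fun i => v ∈ E i).card ≤ Δ := fun v =>
      (Finset.card_le_card (Finset.filter_subset_filter _ (Finset.subset_insert _ _))).trans
        (hdeg v)
    have ih := ih hE' hdeg'
    have hRi := hE i (Finset.mem_insert_self _ _)
    obtain ⟨v, -⟩ : (E i).Nonempty := Finset.card_pos.1 (by omega)
    have : Nonempty V := ⟨v⟩
    have hbd := norm_sum_configWeight_le (E := E) (A := A) (β := β) hk hRi hE' hdeg'
      (ρ := 1 + 16 * (Δ * ε)) (z := 1 + 1 / (D : ℝ)) (y := Real.exp 1 ^ 2 * (1 / 2) ^ k)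
      (by linarith) (by rw [add_lt_add_iff_left, lt_div_iff₀ hD0]; exact hεD)
      (fun v σ => (flipRatio_bound hε (by linarith) hβ hdeg' v σ).1)
      (fun v σ => (flipRatio_bound hε (by linarith) hβ hdeg' v σ).2)
      (by positivity) (percolation_parameters (Nat.succ_pos _) (by linarith)) ih
    set Q := ∑ σ, configWeight E β A σ
    have hQ : 0 < ‖Q‖ := norm_pos_iff.2 ih
    have hy : Real.exp 1 ^ 2 * (1 / 2) ^ k ≤ 1 / 8 :=
      (le_mul_of_one_le_right (by positivity) (one_le_pow₀ hD1)).trans hcond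
    have hk8 : (1 / 2 : ℝ) ^ k ≤ Real.exp 1 ^ 2 * (1 / 2) ^ k :=
      le_mul_of_one_le_left (by positivity) (one_le_pow₀ (Real.one_le_exp (by norm_num)))
    have hβ1 : ‖β i - 1‖ ≤ 1 + ε := by
      obtain ⟨b, hb, h⟩ := hβ i
      calc ‖β i - 1‖ = ‖(β i - b) - ((1 - b : ℝ) : ℂ)‖ := by push_cast; ring_nf
        _ ≤ ‖β i - b‖ + ‖((1 - b : ℝ) : ℂ)‖ := norm_sub_le _ _
        _ ≤ _ := by
          rw [Complex.norm_of_nonneg (by linarith [hb.2])]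
          linarith [hb.1]
    rw [sum_configWeight_insert β hi]
    intro h0
    have hle : ‖Q‖ ≤ 2 * (‖Q‖ * (1 / 4)) := by
      calc ‖Q‖ = ‖(β i - 1) * ∑ σ with E i ⊆ σ, configWeight E β A σ‖ := by
            rw [← norm_neg, eq_neg_of_add_eq_zero_right h0]
        _ ≤ 2 * (‖Q‖ * (1 / 4)) := by
            rw [norm_mul]
            gcongr
            · linarith
            · exact hbd.trans (mul_le_mul_of_nonneg_left (by linarith) hQ.le)
    linarith

end ZeroFreeness

open Classical in
theorem fisherPartition_eq_sum_configWeight {α : Type*} (H : Hypergraph α)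
    [Fintype H.vertexSet] [Fintype H.edgeSet] (β : H.edgeSet → ℂ) :
    H.fisherPartition β = ∑ σ, configWeight
      (fun e : H.edgeSet => Finset.univ.filter fun v : H.vertexSet => (v : α) ∈ (e : Set α))
      β Finset.univ σ := by
  rw [Hypergraph.fisherPartition]
  refine Fintype.sum_bijective (fun σ : H.vertexSet → Fin 2 => Finset.univ.filter fun v => σ v = 1)
    ⟨fun σ τ h => ?_, fun s => ⟨fun v => if v ∈ s then 1 else 0, by ext; simp⟩⟩ _ _ fun σ => ?_
  · funext v
    have := congrArg (v ∈ ·) h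
    simp only [Finset.mem_filter, Finset.mem_univ, true_and, eq_iff_iff] at this
    omega
  · rw [configWeight, Finset.prod_filter]
    refine Finset.prod_congr rfl fun e _ => ?_
    simp [Hypergraph.edgeActivity, Finset.subset_iff]

theorem theorem2 (k Δ : ℕ) (hk : 2 ≤ k) (hΔ : 3 ≤ Δ) (ε : ℝ) (hε : 0 < ε)
    (hε' : ε < 1 / (16 * ((k : ℝ) + 1) ^ 5 * (Δ : ℝ) ^ 2))
    (hcond : Real.sqrt (1 + 2 * ε) * (2 : ℝ) ^ (-(k : ℝ) / 2)
      < 1 / (2 * Real.sqrt 2 * Real.exp 1 * (Δ : ℝ) * ((k : ℝ) + 1) ^ 2))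
    {α : Type*} (H : Hypergraph α) [Fintype H.vertexSet] [Fintype H.edgeSet]
    (hunif : H.IsUniformOfSize k) (hdeg : H.MaxDegreeLE Δ)
    (β : H.edgeSet → ℂ) (hβ : ∀ e, β e ∈ unitSegmentNhd ε) :
    H.fisherPartition β ≠ 0 := by
  classical
  have hkR : (2 : ℝ) ≤ k := by exact_mod_cast hk
  have hΔR : (3 : ℝ) ≤ Δ := by exact_mod_cast hΔ
  set D := k * (Δ * k) + 1 with hD
  have hDle : (D : ℝ) ≤ Δ * ((k : ℝ) + 1) ^ 2 := by
    rw [hD]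
    push_cast
    nlinarith [mul_nonneg (show (0 : ℝ) ≤ Δ by linarith) (show (0 : ℝ) ≤ k by linarith)]
  have hεD : 16 * (Δ * ε) * (D : ℝ) < 1 := by
    rw [lt_div_iff₀ (by positivity)] at hε'
    calc 16 * (Δ * ε) * (D : ℝ) ≤ 16 * (Δ * ε) * (Δ * ((k : ℝ) + 1) ^ 2) := by gcongr
      _ = ε * (16 * ((k : ℝ) + 1) ^ 2 * (Δ : ℝ) ^ 2) := by ring
      _ ≤ ε * (16 * ((k : ℝ) + 1) ^ 5 * (Δ : ℝ) ^ 2) := by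
          gcongr
          · linarith
          · norm_num
      _ < 1 := hε'
  have hD1 : (1 : ℝ) ≤ D := by exact_mod_cast Nat.succ_le_of_lt (Nat.succ_pos _)
  have hε1 : ε ≤ 1 := by
    have h1 : 16 * (Δ * ε) ≤ 16 * (Δ * ε) * (D : ℝ) := le_mul_of_one_le_right (by positivity) hD1
    nlinarith
  have hexp : Real.exp 1 ^ 2 * (1 / 2) ^ k * (D : ℝ) ^ 2 ≤ 1 / 8 := by
    set a := (2 : ℝ) ^ (-(k : ℝ) / 2) with ha
    have ha0 : 0 < a := by positivity
    have ha2 : a ^ 2 = (1 / 2) ^ k := by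
      rw [ha, ← Real.rpow_natCast, ← Real.rpow_mul (by norm_num), one_div, inv_pow,
        ← Real.rpow_natCast, ← Real.rpow_neg (by norm_num)]
      congr 1
      push_cast
      ring
    have hle : a ≤ Real.sqrt (1 + 2 * ε) * a :=
      le_mul_of_one_le_left ha0.le (Real.one_le_sqrt.2 (by linarith))
    have h1 := hle.trans hcond.le
    rw [le_div_iff₀ (by positivity)] at h1
    have h2 : Real.exp 1 * a * D * (2 * Real.sqrt 2) ≤ 1 := by
      calc _ ≤ Real.exp 1 * a * (Δ * ((k : ℝ) + 1) ^ 2) * (2 * Real.sqrt 2) := by gcongr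
        _ = a * (2 * Real.sqrt 2 * Real.exp 1 * (Δ : ℝ) * ((k : ℝ) + 1) ^ 2) := by ring
        _ ≤ 1 := h1
    -- Squaring turns `2 ^ (-k / 2)` into `2 ^ (-k)` and `2 * √2` into `8`.
    have h3 := pow_le_one₀ (n := 2) (by positivity) h2
    have h4 : Real.sqrt 2 ^ 2 = 2 := Real.sq_sqrt (by norm_num)
    rw [mul_pow, mul_pow, mul_pow, mul_pow, h4, ha2] at h3
    linarith
  rw [fisherPartition_eq_sum_configWeight]
  refine sum_configWeight_ne_zero (k := k) (Δ := Δ) (ε := ε) (by omega) hε.le hεD hε1 hexp hβ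
    (fun e _ => ?_) fun v => ?_
  · rw [← (hunif e e.2).2, ← Set.ncard_coe_finset,
      ← Set.ncard_image_of_injective _ Subtype.val_injective]
    congr 1
    ext x
    simp only [Finset.coe_filter, Finset.mem_univ, true_and, Set.mem_image, Set.mem_ofPred_eq,
      Subtype.exists, exists_and_left, exists_prop, exists_eq_right_right]
    exact ⟨fun h => h.1, fun h => ⟨h, H.subset_vertexSet_of_mem_edgeSet' e.2 h⟩⟩
  · refine le_trans (le_of_eq ?_) (hdeg v v.2)
    rw [Hypergraph.vertexDegree, ← Set.ncard_coe_finset,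
      ← Set.ncard_image_of_injective _ Subtype.val_injective]
    congr 1
    ext e
    simp [and_comm]
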